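/- Let $p$ be a prime, $q$ a power of $p$, and $m\ge 1$. Let $g_1,g_2,v_1,v_2\in\mathbb F_q[x]$, where $g_1,g_2$ are monic divisors of $x^m-1$ and $\gcd(v_1v_2-1,\,x^m-1)=1$. For a polynomial $k$, congruent modulo $x^m-1$ to $k_0+k_1x+\dots+k_{m-1}x^{m-1}$, write $[k]=(k_0,\dots,k_{m-1})\in\mathbb F_q^m$ and $\overline{k}=k_0+k_{m-1}x+\dots+k_1x^{m-1}$ (that is, $k(x^{-1})$ modulo $x^m-1$). Let $\mathcal C\subseteq\mathbb F_q^{2m}$ be the 2-generator quasi-cyclic code of length $2m$ and index $2$ generated by $([g_1],[v_1g_1])$ and $([v_2g_2],[g_2])$, i.e. $$\mathcal C=\{([ag_1+bv_2g_2],\,[av_1g_1+bg_2]) : a,b\in\mathbb F_q[x]\}.$$ Put $h_i=(x^m-1)/g_i$ for $i=1,2$, and suppose that $$h_1\mid \overline{g_1}\,(1+v_1\overline{v_1}),\qquad h_1\mid \overline{g_2}\,(\overline{v_2}+v_1),\qquad h_2\mid \overline{g_2}\,(1+v_2\overline{v_2}).$$ Then $\mathcal C$ is Euclidean self-orthogonal,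 $\mathcal C\subseteq\mathcal C^{\perp}$, where $\mathcal C^\perp$ is the dual for $\langle u,v\rangle=\sum_i u_iv_i$, and it is a $[2m,\,2m-\deg g_1-\deg g_2]$ linear code over $\mathbb F_q$. In particular $\deg g_1+\deg g_2\ge m$. Moreover, there exists a quantum stabilizer code with parameters $$[[\,2m,\;2(\deg g_1+\deg g_2-m),\;w(\mathcal C^{\perp}\setminus\mathcal C)\,]]_q .$$ Here $w(S)$ is the minimum Hamming weight of the words in $S$, with $w(\emptyset)=\infty$. An $[[n,k,d]]_q$ quantum stabilizer code is a $q^k$-dimensional subspace $Q$ of $(\mathbb C^q)^{\otimes n}$ that is a joint eigenspace of an abelian subgroup of the error group $\{\omega^cX(a)Z(b): c\in\mathbb F_p,\ a,b\in\mathbb F_q^n\}$, where $\omega=e^{2\pi i/p}$, $X(a)|x\rangle=|x+a\rangle$ and $Z(b)|x\rangle=\omega^{\mathrm{tr}_{\mathbb F_q/\mathbb F_p}(b\cdot x)}|x\rangle$, and that detects every error $E=\omega^cX(a)Z(b)$ whose weight $|\{i:(a_i,b_i)\ne(0,0)\}|$ is less than $d$; that $Q$ detects $E$ means that for some $z\in\mathbb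 C$, $\langle\varphi|E|\psi\rangle=z\langle\varphi|\psi\rangle$ for all $\varphi,\psi\in Q$. -/

import Mathlib

open Polynomial

namespace QuasiCyclic

/-! ### Polynomials modulo `X ^ m - 1` and quasi-cyclic codes of index two -/

section Classical

variable {F : Type*} [Field F]

/-- The vector `[k(x)] = (k_0, …, k_{m-1})` of the coefficients of the representative of degree
`< m` of `k` modulo `X ^ m - 1`. -/
noncomputable def coeffVec (m : ℕ) : F[X] →ₗ[F] (Fin m → F) :=
  LinearMap.pi fun i => (lcoeff F (i : ℕ)).comp (modByMonicHom (X ^ m - 1 : F[X]))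

/-- The pair of polynomials `(a, b)` as the word `([a(x)], [b(x)])` of length `2m`; the two blocks
of `m` coordinates are the two summands of `Fin m ⊕ Fin m`. -/
noncomputable def blockVec (m : ℕ) : (F[X] × F[X]) →ₗ[F] (Fin m ⊕ Fin m → F) where
  toFun k := Sum.elim (coeffVec m k.1) (coeffVec m k.2)
  map_add' k l := by
    funext i
    cases i <;> simp
  map_smul' r k := by
    funext i
    cases i <;> simp

/-- The quasi-cyclic code of length `2m` and index `2` generated by a set of pairs of polynomials:
the words of all combinations of the generators with polynomial coefficients, reduced modulo
`X ^ m - 1`. -/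
noncomputable def qcCode (m : ℕ) (S : Set (F[X] × F[X])) : Submodule F (Fin m ⊕ Fin m → F) :=
  ((Submodule.span F[X] S).restrictScalars F).map (blockVec m)

/-- The code generated by `([g₁], [v₁ g₁])` and `([v₂ g₂], [g₂])`. -/
noncomputable def twoGenCode (m : ℕ) (g₁ g₂ v₁ v₂ : F[X]) : Submodule F (Fin m ⊕ Fin m → F) :=
  qcCode m {(g₁, v₁ * g₁), (v₂ * g₂, g₂)}

/-- The conjugate `k(x⁻¹) mod (x ^ m - 1)`, that is `k_0 + k_{m-1} x + ⋯ + k_1 x ^ (m-1)`, where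
the `k_i` are the coefficients of `k` modulo `X ^ m - 1`. -/
noncomputable def bar (m : ℕ) (k : F[X]) : F[X] :=
  ∑ i : Fin m, C (coeffVec m k i) * X ^ ((m - (i : ℕ)) % m)

/-- The parity-check polynomial `(x ^ m - 1) / g`. -/
noncomputable def parityCheck (m : ℕ) (g : F[X]) : F[X] := (X ^ m - 1) / g

end Classical

/-! ### Linear codes -/

section Codes

variable {F : Type*} [Field F] {ι : Type*} [Fintype ι]

/-- `C` is an `[n, k]` linear code; its coordinates are indexed by `ι`. -/
def IsLinearCode (C : Submodule F (ι → F)) (n k : ℕ) : Prop :=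
  Fintype.card ι = n ∧ Module.finrank F C = k

/-- The Euclidean dual code. -/
def euclideanDual (C : Submodule F (ι → F)) : Submodule F (ι → F) where
  carrier := {u | ∀ c ∈ C, u ⬝ᵥ c = 0}
  zero_mem' := by
    intro c _
    simp
  add_mem' := by
    intro u v hu hv c hc
    rw [add_dotProduct, hu c hc, hv c hc, add_zero]
  smul_mem' := by
    intro r u hu c hc
    rw [smul_dotProduct, hu c hc, smul_zero]

/-- `C` is contained in its Euclidean dual. -/
def IsEuclideanSelfOrthogonal (C : Submodule F (ι → F)) : Prop := C ≤ euclideanDual C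

/-- The minimum Hamming weight `w(S)` of a set of words (`⊤` if the set is empty). -/
noncomputable def minWeight [DecidableEq F] (S : Set (ι → F)) : ℕ∞ :=
  ⨅ c ∈ S, (hammingNorm c : ℕ∞)

end Codes

/-! ### Quantum stabilizer codes

The state space of qudits indexed by `ι`, each with basis `F`, is `(ι → F) → ℂ`, a tensor product
of copies of `ℂ ^ q`; operators are matrices in the computational basis `|x⟩`, `x : ι → F`. -/

section Quantum

variable (p : ℕ) [Fact p.Prime] {F : Type*} [Field F] [Fintype F] [DecidableEq F]
  [Algebra (ZMod p) F] {ι : Type*} [Fintype ι] [DecidableEq ι]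

/-- Operators on the state space. -/
abbrev Operator (ι F : Type*) := Matrix (ι → F) (ι → F) ℂ

/-- The shift `X(a) |x⟩ = |x + a⟩`. -/
def shiftOp (a : ι → F) : Operator ι F := Matrix.of fun y x => if y = x + a then 1 else 0

/-- The phase operator `Z(b) |x⟩ = ω ^ tr(b · x) |x⟩`, with `ω = exp (2πi / p)` and the trace
from `F` to its prime field. -/
noncomputable def phaseOp (b : ι → F) : Operator ι F :=
  Matrix.diagonal fun x => ZMod.stdAddChar (Algebra.trace (ZMod p) F (b ⬝ᵥ x))

/-- The error `ω ^ c X(a) Z(b)`. -/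
noncomputable def errorOp (c : ZMod p) (a b : ι → F) : Operator ι F :=
  (ZMod.stdAddChar c : ℂ) • (shiftOp a * phaseOp p b)

theorem errorOp_apply (c : ZMod p) (a b y x : ι → F) :
    errorOp p c a b y x =
      if y = x + a then ZMod.stdAddChar (c + Algebra.trace (ZMod p) F (b ⬝ᵥ x)) else 0 := by
  simp [errorOp, shiftOp, phaseOp, Matrix.mul_diagonal, AddChar.map_add_eq_mul]

theorem errorOp_zero : errorOp p 0 (0 : ι → F) 0 = 1 := by
  ext y x
  simp [errorOp_apply, Matrix.one_apply]

theorem errorOp_mul (c c' : ZMod p) (a a' b b' : ι → F) :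
    errorOp p c a b * errorOp p c' a' b' =
      errorOp p (c + c' + Algebra.trace (ZMod p) F (b ⬝ᵥ a')) (a + a') (b + b') := by
  ext y x
  simp only [Matrix.mul_apply, errorOp_apply]
  rw [Finset.sum_eq_single (x + a')]
  · have h : x + a' + a = x + (a + a') := by abel
    rw [h, if_pos rfl]
    by_cases hy : y = x + (a + a')
    · rw [if_pos hy, if_pos hy, ← AddChar.map_add_eq_mul, dotProduct_add, add_dotProduct,
        map_add (Algebra.trace (ZMod p) F), map_add (Algebra.trace (ZMod p) F)]
      congr 1
      abel
    · rw [if_neg hy, if_neg hy, zero_mul]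
  · intro z _ hz
    simp [hz]
  · simp

/-- The error group: all operators `ω ^ c X(a) Z(b)`. -/
def errorGroup : Subgroup (Operator ι F)ˣ where
  carrier := {U | ∃ (c : ZMod p) (a b : ι → F), (U : Operator ι F) = errorOp p c a b}
  one_mem' := ⟨0, 0, 0, by rw [errorOp_zero, Units.val_one]⟩
  mul_mem' := by
    rintro U V ⟨c, a, b, hU⟩ ⟨c', a', b', hV⟩
    exact ⟨_, _, _, by rw [Units.val_mul, hU, hV, errorOp_mul]⟩
  inv_mem' := by
    rintro U ⟨c, a, b, hU⟩
    refine ⟨-c + Algebra.trace (ZMod p) F (b ⬝ᵥ a), -a, -b, ?_⟩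
    rw [Units.inv_eq_of_mul_eq_one_right]
    rw [hU, errorOp_mul, ← errorOp_zero p]
    congr 1 <;> simp

/-- The weight of an error `ω ^ c X(a) Z(b)`: the number of qudits on which it acts
nontrivially. -/
def errorWeight (a b : ι → F) : ℕ := (Finset.univ.filter fun i => a i ≠ 0 ∨ b i ≠ 0).card

/-- `Q` is the joint eigenspace of an abelian subgroup `S` of the error group; `χ` records the
eigenvalues. -/
def IsStabilizerCode (Q : Submodule ℂ ((ι → F) → ℂ)) : Prop :=
  ∃ S : Subgroup (Operator ι F)ˣ, S ≤ errorGroup p ∧ (∀ A ∈ S, ∀ B ∈ S, A * B = B * A) ∧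
    ∃ χ : S → ℂ, ∀ ψ : (ι → F) → ℂ,
      ψ ∈ Q ↔ ∀ A : S, ((A : (Operator ι F)ˣ) : Operator ι F).mulVec ψ = χ A • ψ

/-- `Q` detects the error `E`: the compression of `E` to `Q` is a scalar, that is
`⟨φ, E ψ⟩ = z ⟨φ, ψ⟩` for all `φ, ψ ∈ Q`. -/
def Detects (Q : Submodule ℂ ((ι → F) → ℂ)) (E : Operator ι F) : Prop :=
  ∃ z : ℂ, ∀ φ ∈ Q, ∀ ψ ∈ Q, star φ ⬝ᵥ E.mulVec ψ = z * (star φ ⬝ᵥ ψ)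

/-- `Q` is an `[[n, k, d]]_q` quantum stabilizer code, `q = |F|`: a stabilizer code that encodes
`k` qudits into `n` qudits and detects all errors of weight less than `d`. -/
structure IsQuantumStabilizerCode (Q : Submodule ℂ ((ι → F) → ℂ)) (n k : ℕ) (d : ℕ∞) : Prop where
  length : Fintype.card ι = n
  stabilizer : IsStabilizerCode p Q
  dimension : Module.finrank ℂ Q = Fintype.card F ^ k
  detects : ∀ (c : ZMod p) (a b : ι → F), (errorWeight a b : ℕ∞) < d → Detects Q (errorOp p c a b)

end Quantum

end QuasiCyclic

/-! In `F[x]/(x^m-1)` conjugation is the ring endomorphism `x ↦ x^(m-1) = x⁻¹` (`mk_bar`), and a dot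
product of coefficient vectors is the constant coefficient of `k * bar l` (`coeffVec_dotProduct`).
Orthogonality of all multiples of the generators thus reduces to three congruences, which are the
divisibility hypotheses multiplied by `g₁` or `g₂`. As `v₁v₂ - 1` is a unit modulo `x^m-1`, the two
generators contribute independently, with dimensions `m - deg gᵢ`; self-orthogonality then gives the
degree bound.

For any self-orthogonal `C` of length `n`, the operators `X(a)Z(b)` with `a, b ∈ C` commute. Their
fixed states are the functions supported on `Cᗮ` and constant on cosets of `C`
(`mem_stabilizedSpace_iff`), a space of dimension `|Cᗮ/C| = q^(n - 2 dim C)`. An error with `a` or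
`b` outside `Cᗮ` compresses to zero; one with `a, b ∈ C` acts as a scalar. Any other error has
weight at least `w(Cᗮ \ C)`. -/

namespace QuasiCyclic

/-! ### Euclidean duals and functions on the quotient of the dual by the code. -/

section DualCodes

variable {F : Type*} [Field F] {ι : Type*} [Fintype ι]

theorem mem_euclideanDual {C : Submodule F (ι → F)} {u : ι → F} :
    u ∈ euclideanDual C ↔ ∀ c ∈ C, u ⬝ᵥ c = 0 := Iff.rfl

theorem finrank_euclideanDual (C : Submodule F (ι → F)) :
    Module.finrank F (euclideanDual C) = Fintype.card ι - Module.finrank F C := by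
  let B : LinearMap.BilinForm F (ι → F) :=
    LinearMap.mk₂ F (fun u v => u ⬝ᵥ v) add_dotProduct (fun r u v => smul_dotProduct r u v)
      dotProduct_add (fun r u v => dotProduct_smul r u v)
  have hB : ∀ u v, B u v = u ⬝ᵥ v := fun _ _ => rfl
  have hn : B.Nondegenerate := by
    refine ⟨fun u hu => dotProduct_eq_zero u hu, fun u hu => dotProduct_eq_zero u fun w => ?_⟩
    rw [dotProduct_comm]
    exact hu w
  have hD : euclideanDual C = B.orthogonal C := by
    ext u
    rw [mem_euclideanDual, LinearMap.BilinForm.mem_orthogonal_iff]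
    exact forall₂_congr fun c _ => by rw [dotProduct_comm, ← hB]
  rw [hD, LinearMap.BilinForm.finrank_orthogonal hn, Module.finrank_fintype_fun_eq_card]

theorem IsEuclideanSelfOrthogonal.two_mul_finrank_le {C : Submodule F (ι → F)}
    (hC : IsEuclideanSelfOrthogonal C) : 2 * Module.finrank F C ≤ Fintype.card ι := by
  have h₁ := Submodule.finrank_mono hC
  rw [finrank_euclideanDual] at h₁
  have h₂ := Submodule.finrank_le C
  rw [Module.finrank_fintype_fun_eq_card] at h₂
  omega

theorem not_lt_minWeight_of_mem [DecidableEq F] {S : Set (ι → F)} {u : ι → F} {n : ℕ}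
    (hu : u ∈ S) (hn : hammingNorm u ≤ n) : ¬(n : ℕ∞) < minWeight S :=
  not_lt.2 ((iInf₂_le u hu).trans (Nat.cast_le.2 hn))

open Classical in
/-- A function on `Cᗮ / C` as a function on all words that vanishes outside `Cᗮ`. -/
noncomputable def cosetExtension (C : Submodule F (ι → F)) :
    ((euclideanDual C ⧸ C.submoduleOf (euclideanDual C)) → ℂ) →ₗ[ℂ] ((ι → F) → ℂ) where
  toFun f x := if hx : x ∈ euclideanDual C then f (Submodule.Quotient.mk ⟨x, hx⟩) else 0
  map_add' f g := by
    funext x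
    by_cases hx : x ∈ euclideanDual C <;> simp [hx]
  map_smul' r f := by
    funext x
    by_cases hx : x ∈ euclideanDual C <;> simp [hx]

theorem cosetExtension_of_mem {C : Submodule F (ι → F)}
    (f : (euclideanDual C ⧸ C.submoduleOf (euclideanDual C)) → ℂ) {x : ι → F}
    (hx : x ∈ euclideanDual C) :
    cosetExtension C f x = f (Submodule.Quotient.mk ⟨x, hx⟩) := dif_pos hx

theorem cosetExtension_of_notMem {C : Submodule F (ι → F)}
    (f : (euclideanDual C ⧸ C.submoduleOf (euclideanDual C)) → ℂ) {x : ι → F}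
    (hx : x ∉ euclideanDual C) : cosetExtension C f x = 0 := dif_neg hx

theorem cosetExtension_injective (C : Submodule F (ι → F)) :
    Function.Injective (cosetExtension C) := by
  intro f g h
  funext y
  obtain ⟨⟨x, hx⟩, rfl⟩ := Submodule.Quotient.mk_surjective _ y
  rw [← cosetExtension_of_mem f hx, ← cosetExtension_of_mem g hx, h]

end DualCodes

/-! ### Duality through the trace to the prime field. -/

section Trace

variable (p : ℕ) [Fact p.Prime] {F : Type*} [Field F] [Finite F] [Algebra (ZMod p) F]

theorem eq_zero_of_trace_smul_eq_zero {x : F}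
    (h : ∀ r : F, Algebra.trace (ZMod p) F (r * x) = 0) : x = 0 :=
  (traceForm_nondegenerate (ZMod p) F).2 x h

/-- Phases only see traces. Nothing is lost because `C` is closed under scaling by `F` and the trace
form is nondegenerate. -/
theorem mem_euclideanDual_iff_trace {ι : Type*} [Fintype ι] {C : Submodule F (ι → F)} {u : ι → F} :
    u ∈ euclideanDual C ↔ ∀ c ∈ C, Algebra.trace (ZMod p) F (c ⬝ᵥ u) = 0 := by
  refine ⟨fun hu c hc => by rw [dotProduct_comm, hu c hc, map_zero], fun h c hc => ?_⟩
  refine eq_zero_of_trace_smul_eq_zero p fun r => ?_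
  have := h (r • c) (C.smul_mem r hc)
  rwa [smul_dotProduct, smul_eq_mul, dotProduct_comm] at this

end Trace

/-! ### The stabilizer code of a self-orthogonal code. -/

section Stabilizer

variable (p : ℕ) [Fact p.Prime] {F : Type*} [Field F] [Fintype F] [DecidableEq F]
  [Algebra (ZMod p) F] {ι : Type*} [Fintype ι] [DecidableEq ι]

theorem errorOp_mulVec (c : ZMod p) (a b : ι → F) (ψ : (ι → F) → ℂ) (y : ι → F) :
    (errorOp p c a b).mulVec ψ y =
      ZMod.stdAddChar (c + Algebra.trace (ZMod p) F (b ⬝ᵥ (y - a))) * ψ (y - a) := by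
  rw [Matrix.mulVec, dotProduct, Finset.sum_eq_single (y - a)]
  · simp [errorOp_apply]
  · intro x _ hx
    rw [errorOp_apply, if_neg, zero_mul]
    rintro rfl
    simp at hx
  · simp

/-- The operators `X(a) Z(b)` with `a` and `b` in a self-orthogonal code. -/
def stabilizerGroup (C : Submodule F (ι → F)) (hC : IsEuclideanSelfOrthogonal C) :
    Subgroup (Operator ι F)ˣ where
  carrier := {U | ∃ a ∈ C, ∃ b ∈ C, (U : Operator ι F) = errorOp p 0 a b}
  one_mem' := ⟨0, C.zero_mem, 0, C.zero_mem, by rw [errorOp_zero, Units.val_one]⟩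
  mul_mem' := by
    rintro U V ⟨a, ha, b, hb, hU⟩ ⟨a', ha', b', hb', hV⟩
    refine ⟨_, C.add_mem ha ha', _, C.add_mem hb hb', ?_⟩
    rw [Units.val_mul, hU, hV, errorOp_mul, hC hb a' ha', map_zero, add_zero, add_zero]
  inv_mem' := by
    rintro U ⟨a, ha, b, hb, hU⟩
    refine ⟨-a, C.neg_mem ha, -b, C.neg_mem hb, ?_⟩
    rw [Units.inv_eq_of_mul_eq_one_right]
    rw [hU, errorOp_mul, ← errorOp_zero p]
    congr 1 <;> simp [hC hb a ha]

/-- The states fixed by all `X(a) Z(b)` with `a` and `b` in the code `C`. -/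
noncomputable def stabilizedSpace (C : Submodule F (ι → F)) : Submodule ℂ ((ι → F) → ℂ) where
  carrier := {ψ | ∀ a ∈ C, ∀ b ∈ C, (errorOp p 0 a b).mulVec ψ = ψ}
  zero_mem' := fun a _ b _ => Matrix.mulVec_zero _
  add_mem' := fun hφ hψ a ha b hb => by rw [Matrix.mulVec_add, hφ a ha b hb, hψ a ha b hb]
  smul_mem' := fun r ψ hψ a ha b hb => by rw [Matrix.mulVec_smul, hψ a ha b hb]

/-- The stabilized states are the functions on `Cᗮ` that are constant on the cosets of `C`. -/
theorem mem_stabilizedSpace_iff {C : Submodule F (ι → F)} (hC : IsEuclideanSelfOrthogonal C)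
    {ψ : (ι → F) → ℂ} :
    ψ ∈ stabilizedSpace p C ↔
      (∀ x, x ∉ euclideanDual C → ψ x = 0) ∧ ∀ a ∈ C, ∀ x, ψ (x - a) = ψ x := by
  constructor
  · intro h
    refine ⟨fun x hx => ?_, fun a ha x => ?_⟩
    · by_contra hψ
      refine hx ((mem_euclideanDual_iff_trace p).2 fun b hb => ?_)
      have h₁ := congrFun (h 0 C.zero_mem b hb) x
      rw [errorOp_mulVec, sub_zero, zero_add] at h₁
      -- `Z(b)` multiplies the nonzero value `ψ x` by a phase, which must be 1; the additive
      -- character is injective, so the trace vanishes.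
      have h₂ := mul_right_cancel₀ hψ (h₁.trans (one_mul _).symm)
      rw [← AddChar.map_zero_eq_one (ZMod.stdAddChar (N := p))] at h₂
      exact ZMod.injective_stdAddChar h₂
    · have h₁ := congrFun (h a ha 0 C.zero_mem) x
      rwa [errorOp_mulVec, zero_dotProduct, map_zero, add_zero, AddChar.map_zero_eq_one,
        one_mul] at h₁
  · rintro ⟨h₁, h₂⟩ a ha b hb
    funext y
    rw [errorOp_mulVec, h₂ a ha]
    by_cases hy : y ∈ euclideanDual C
    · rw [dotProduct_comm, (Submodule.sub_mem _ hy (hC ha)) b hb, map_zero, add_zero,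
        AddChar.map_zero_eq_one, one_mul]
    · rw [h₁ y hy, mul_zero]

theorem isStabilizerCode_stabilizedSpace {C : Submodule F (ι → F)}
    (hC : IsEuclideanSelfOrthogonal C) : IsStabilizerCode p (stabilizedSpace p C) := by
  refine ⟨stabilizerGroup p C hC, ?_, ?_, fun _ => 1, fun ψ => ⟨?_, ?_⟩⟩
  · rintro U ⟨a, _, b, _, hU⟩
    exact ⟨0, a, b, hU⟩
  · rintro U ⟨a, ha, b, hb, hU⟩ V ⟨a', ha', b', hb', hV⟩
    ext1
    rw [Units.val_mul, Units.val_mul, hU, hV, errorOp_mul, errorOp_mul, hC hb a' ha',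
      hC hb' a ha, add_comm a, add_comm b]
  · rintro h ⟨U, a, ha, b, hb, hU⟩
    rw [one_smul]
    exact (congrArg (fun M => Matrix.mulVec M ψ) hU).trans (h a ha b hb)
  · intro h a ha b hb
    let U : (Operator ι F)ˣ :=
      ⟨errorOp p 0 a b, errorOp p 0 (-a) (-b),
        by rw [errorOp_mul, ← errorOp_zero p]; congr 1 <;> simp [hC hb a ha],
        by rw [errorOp_mul, ← errorOp_zero p]; congr 1 <;> simp [hC hb a ha]⟩
    simpa using h ⟨U, a, ha, b, hb, rfl⟩

theorem range_cosetExtension {C : Submodule F (ι → F)} (hC : IsEuclideanSelfOrthogonal C) :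
    LinearMap.range (cosetExtension C) = stabilizedSpace p C := by
  ext ψ
  rw [mem_stabilizedSpace_iff p hC]
  constructor
  · rintro ⟨f, rfl⟩
    refine ⟨fun x hx => cosetExtension_of_notMem f hx, fun a ha x => ?_⟩
    by_cases hx : x ∈ euclideanDual C
    · rw [cosetExtension_of_mem f hx, cosetExtension_of_mem f (Submodule.sub_mem _ hx (hC ha))]
      congr 1
      rw [Submodule.Quotient.eq]
      change x - a - x ∈ C
      simpa using ha
    · rw [cosetExtension_of_notMem f hx, cosetExtension_of_notMem]
      exact fun h => hx (by simpa using Submodule.add_mem _ h (hC ha))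
  · rintro ⟨h₁, h₂⟩
    -- The preimage evaluates `ψ` at coset representatives; constancy on cosets makes the choice of
    -- `s` harmless.
    obtain ⟨s, hs⟩ :=
      (Submodule.Quotient.mk_surjective (C.submoduleOf (euclideanDual C))).hasRightInverse
    refine ⟨fun y => ψ (s y), ?_⟩
    funext x
    by_cases hx : x ∈ euclideanDual C
    · rw [cosetExtension_of_mem _ hx]
      have h₃ : x - s (Submodule.Quotient.mk ⟨x, hx⟩) ∈ C :=
        (Submodule.Quotient.eq (C.submoduleOf (euclideanDual C))).1 (hs (Submodule.Quotient.mk ⟨x, hx⟩)).symm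
      simpa using h₂ _ h₃ x
    · rw [cosetExtension_of_notMem _ hx, h₁ x hx]

theorem finrank_stabilizedSpace {C : Submodule F (ι → F)} (hC : IsEuclideanSelfOrthogonal C) :
    Module.finrank ℂ (stabilizedSpace p C) =
      Fintype.card F ^ (Fintype.card ι - 2 * Module.finrank F C) := by
  classical
  have : Fintype (euclideanDual C ⧸ C.submoduleOf (euclideanDual C)) := Fintype.ofFinite _
  rw [← range_cosetExtension p hC, LinearMap.finrank_range_of_inj (cosetExtension_injective C),
    Module.finrank_fintype_fun_eq_card, Module.card_eq_pow_finrank (K := F)]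
  congr 1
  have h₁ := Submodule.finrank_quotient_add_finrank (C.submoduleOf (euclideanDual C))
  rw [finrank_euclideanDual, (Submodule.submoduleOfEquivOfLe hC).finrank_eq] at h₁
  omega

theorem detects_stabilizedSpace {C : Submodule F (ι → F)} (hC : IsEuclideanSelfOrthogonal C)
    (c : ZMod p) (a b : ι → F)
    (h : (errorWeight a b : ℕ∞) < minWeight {u : ι → F | u ∈ euclideanDual C ∧ u ∉ C}) :
    Detects (stabilizedSpace p C) (errorOp p c a b) := by
  have hwa : hammingNorm a ≤ errorWeight a b :=
    Finset.card_le_card fun i hi => by simp at hi ⊢; exact Or.inl hi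
  have hwb : hammingNorm b ≤ errorWeight a b :=
    Finset.card_le_card fun i hi => by simp at hi ⊢; exact Or.inr hi
  by_cases ha : a ∈ euclideanDual C
  · by_cases hb : b ∈ euclideanDual C
    -- Both `a` and `b` have Hamming weight at most that of the error, too small for a word of `Cᗮ`
    -- outside `C`.
    · have haC : a ∈ C := by
        by_contra ha'
        exact not_lt_minWeight_of_mem (And.intro ha ha') hwa h
      have hbC : b ∈ C := by
        by_contra hb'
        exact not_lt_minWeight_of_mem (And.intro hb hb') hwb h
      refine ⟨ZMod.stdAddChar c, fun φ _ ψ hψ => ?_⟩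
      have h₁ : errorOp p c a b = (ZMod.stdAddChar c : ℂ) • errorOp p 0 a b := by
        simp [errorOp]
      rw [h₁, Matrix.smul_mulVec, hψ a haC b hbC, dotProduct_smul, smul_eq_mul]
    · obtain ⟨e, he, hbe⟩ : ∃ e ∈ C, Algebra.trace (ZMod p) F (e ⬝ᵥ b) ≠ 0 := by
        by_contra! h'
        exact hb ((mem_euclideanDual_iff_trace p).2 h')
      refine ⟨0, fun φ hφ ψ hψ => ?_⟩
      rw [mem_stabilizedSpace_iff p hC] at hφ hψ
      set T := star φ ⬝ᵥ (errorOp p c a b).mulVec ψ with hT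
      have h₁ : T = ZMod.stdAddChar (-Algebra.trace (ZMod p) F (e ⬝ᵥ b)) * T := by
        -- Translation by `e ∈ C` fixes `φ` and `ψ` but multiplies the matrix element by a phase
        -- different from 1, so the element is zero.
        conv_lhs => rw [hT, dotProduct, ← (Equiv.subRight e).sum_comp]
        rw [show T = ∑ x, star φ x * (errorOp p c a b).mulVec ψ x from rfl, Finset.mul_sum]
        refine Finset.sum_congr rfl fun x _ => ?_
        rw [Equiv.subRight_apply, errorOp_mulVec, errorOp_mulVec, Pi.star_apply, Pi.star_apply,
          hφ.2 e he, sub_right_comm, hψ.2 e he, dotProduct_sub, map_sub, dotProduct_comm b e,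
          sub_eq_add_neg, ← add_assoc, AddChar.map_add_eq_mul]
        ring
      by_contra hT0
      rw [zero_mul] at hT0
      have h₂ := mul_right_cancel₀ hT0 ((one_mul _).trans h₁)
      rw [← AddChar.map_zero_eq_one (ZMod.stdAddChar (N := p))] at h₂
      exact hbe (neg_eq_zero.1 (ZMod.injective_stdAddChar h₂).symm)
  · refine ⟨0, fun φ hφ ψ hψ => ?_⟩
    rw [mem_stabilizedSpace_iff p hC] at hφ hψ
    rw [zero_mul, dotProduct]
    refine Finset.sum_eq_zero fun y _ => ?_
    rw [errorOp_mulVec, Pi.star_apply]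
    -- As `a ∉ Cᗮ`, the points `y` and `y - a` cannot both lie in `Cᗮ`, so every summand vanishes.
    by_cases hy : y ∈ euclideanDual C
    · rw [hψ.1 (y - a), mul_zero, mul_zero]
      exact fun h' => ha (by simpa using Submodule.sub_mem _ hy h')
    · rw [hφ.1 y hy, star_zero, zero_mul]

/-- The stabilizer code of a Euclidean self-orthogonal code. -/
theorem isQuantumStabilizerCode_stabilizedSpace {C : Submodule F (ι → F)}
    (hC : IsEuclideanSelfOrthogonal C) :
    IsQuantumStabilizerCode p (stabilizedSpace p C) (Fintype.card ι)
      (Fintype.card ι - 2 * Module.finrank F C)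
      (minWeight {u : ι → F | u ∈ euclideanDual C ∧ u ∉ C}) where
  length := rfl
  stabilizer := isStabilizerCode_stabilizedSpace p hC
  dimension := finrank_stabilizedSpace p hC
  detects := detects_stabilizedSpace p hC

end Stabilizer

end QuasiCyclic

namespace QuasiCyclic

/-! ### Conjugation, orthogonality and dimension modulo `x^m - 1`. -/

section Cyclic

variable {F : Type*} [Field F] {m : ℕ}

theorem monic_X_pow_sub_one (hm : 0 < m) : (X ^ m - 1 : F[X]).Monic := by
  simpa using monic_X_pow_sub_C (1 : F) hm.ne'

theorem natDegree_X_pow_sub_one (m : ℕ) : (X ^ m - 1 : F[X]).natDegree = m := by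
  simpa using natDegree_X_pow_sub_C (n := m) (r := (1 : F))

theorem coeffVec_apply (k : F[X]) (i : Fin m) :
    coeffVec m k i = (k %ₘ (X ^ m - 1)).coeff i := rfl

theorem coeffVec_eq_zero_iff (hm : 0 < m) {k : F[X]} :
    coeffVec m k = 0 ↔ X ^ m - 1 ∣ k := by
  rw [← modByMonic_eq_zero_iff_dvd (monic_X_pow_sub_one hm)]
  constructor
  · intro h
    ext j
    rw [coeff_zero]
    by_cases hj : j < m
    · exact congrFun h ⟨j, hj⟩
    · refine coeff_eq_zero_of_degree_lt
        ((degree_modByMonic_lt _ (monic_X_pow_sub_one hm)).trans_le ?_)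
      rw [degree_eq_natDegree (monic_X_pow_sub_one hm).ne_zero, natDegree_X_pow_sub_one]
      exact_mod_cast not_lt.1 hj
  · intro h
    funext i
    rw [coeffVec_apply, h, coeff_zero, Pi.zero_apply]

theorem coeffVec_eq_iff (hm : 0 < m) {k l : F[X]} :
    coeffVec m k = coeffVec m l ↔ X ^ m - 1 ∣ k - l := by
  rw [← coeffVec_eq_zero_iff hm, map_sub, sub_eq_zero]

theorem X_pow_sub_one_dvd_X_pow_sub_X_pow {i j : ℕ} (h : i ≡ j [MOD m]) :
    (X ^ m - 1 : F[X]) ∣ X ^ i - X ^ j := by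
  wlog hij : j ≤ i generalizing i j
  · rw [← neg_sub (X ^ j), dvd_neg]
    exact this h.symm (not_le.1 hij).le
  obtain ⟨k, hk⟩ := (Nat.modEq_iff_dvd' hij).1 h.symm
  obtain rfl : i = j + m * k := by omega
  rw [pow_add, pow_mul, ← mul_sub_one]
  exact (sub_one_dvd_pow_sub_one (X ^ m : F[X]) k).mul_left _

theorem coeffVec_X_pow (hm : 0 < m) (j : ℕ) :
    coeffVec m (X ^ j : F[X]) = Pi.single ⟨j % m, Nat.mod_lt j hm⟩ 1 := by
  rw [(coeffVec_eq_iff hm).2 (X_pow_sub_one_dvd_X_pow_sub_X_pow (Nat.mod_modEq j m).symm)]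
  funext i
  rw [coeffVec_apply, (modByMonic_eq_self_iff (monic_X_pow_sub_one hm)).2, coeff_X_pow,
    Pi.single_apply]
  · simp [Fin.ext_iff]
  · rw [degree_X_pow, degree_eq_natDegree (monic_X_pow_sub_one hm).ne_zero,
      natDegree_X_pow_sub_one]
    exact_mod_cast Nat.mod_lt j hm

/-- The conjugation `bar` as a linear map. -/
noncomputable def barLinear (m : ℕ) : F[X] →ₗ[F] F[X] where
  toFun := bar m
  map_add' k l := by simp [bar, add_mul, Finset.sum_add_distrib]
  map_smul' r k := by
    simp only [bar, map_smul, Pi.smul_apply, smul_eq_mul, map_mul, mul_assoc, Finset.smul_sum,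
      RingHom.id_apply]
    exact Finset.sum_congr rfl fun i _ => (smul_eq_C_mul r).symm

theorem bar_X_pow (hm : 0 < m) (j : ℕ) : bar m (X ^ j : F[X]) = X ^ ((m - j % m) % m) := by
  rw [bar, coeffVec_X_pow hm, Finset.sum_eq_single ⟨j % m, Nat.mod_lt j hm⟩]
  · simp
  · intro i _ hi
    simp [Pi.single_eq_of_ne hi]
  · simp

/-- The conjugation as the substitution of `x ^ (m - 1)` for `x` modulo `x ^ m - 1`. -/
theorem mk_bar (hm : 0 < m) (k : F[X]) :
    AdjoinRoot.mk (X ^ m - 1) (bar m k) =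
      aeval (AdjoinRoot.root (X ^ m - 1 : F[X]) ^ (m - 1)) k := by
  have h : (AdjoinRoot.mkₐ (R := F) (X ^ m - 1 : F[X])).toLinearMap ∘ₗ barLinear m =
      (aeval (AdjoinRoot.root (X ^ m - 1 : F[X]) ^ (m - 1))).toLinearMap := by
    -- By linearity monomials suffice, and there the claim is `-j ≡ (m - 1) j` modulo `m`.
    refine lhom_ext' fun j => LinearMap.ext_ring ?_
    change AdjoinRoot.mk _ (bar m (monomial j 1)) = aeval _ (monomial j 1)
    rw [← X_pow_eq_monomial, bar_X_pow hm, map_pow (aeval _), aeval_X, ← AdjoinRoot.mk_X, ← map_pow,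
      ← map_pow, ← pow_mul, AdjoinRoot.mk_eq_mk]
    refine X_pow_sub_one_dvd_X_pow_sub_X_pow ((Nat.mod_modEq _ _).trans ?_)
    have h₁ : j % m ≡ j [MOD m] := Nat.mod_modEq j m
    have h₂ : m - j % m + j % m ≡ (m - 1) * j + j [MOD m] := by
      rw [Nat.sub_add_cancel (Nat.mod_lt j hm).le, ← Nat.succ_mul, Nat.succ_eq_add_one,
        Nat.sub_add_cancel hm]
      exact (Nat.modEq_zero_iff_dvd.2 dvd_rfl).trans
        (Nat.modEq_zero_iff_dvd.2 (dvd_mul_right m j)).symm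
    exact Nat.ModEq.add_right_cancel h₁ h₂
  exact LinearMap.congr_fun h k

/-- The dot product of two coefficient vectors is the constant coefficient of `k * bar l`. -/
theorem coeffVec_dotProduct (hm : 0 < m) (k l : F[X]) :
    coeffVec m k ⬝ᵥ coeffVec m l = coeffVec m (k * bar m l) ⟨0, hm⟩ := by
  let A : F[X] →ₗ[F] F[X] →ₗ[F] F :=
    (LinearMap.mk₂ F (fun u v : Fin m → F => u ⬝ᵥ v) add_dotProduct
      (fun r u v => smul_dotProduct r u v) dotProduct_add
      (fun r u v => dotProduct_smul r u v)).compl₁₂ (coeffVec m) (coeffVec m)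
  let B : F[X] →ₗ[F] F[X] →ₗ[F] F :=
    ((LinearMap.mul F F[X]).compl₂ (barLinear m)).compr₂
      ((LinearMap.proj ⟨0, hm⟩).comp (coeffVec m))
  have h : A = B := by
    -- By bilinearity only `x^i` and `x^j` matter: both sides are 1 if `i ≡ j` modulo `m`, and 0
    -- otherwise.
    refine lhom_ext' fun i => LinearMap.ext_ring (lhom_ext' fun j => LinearMap.ext_ring ?_)
    change coeffVec m (monomial i (1 : F)) ⬝ᵥ coeffVec m (monomial j (1 : F)) =
      coeffVec m (monomial i (1 : F) * bar m (monomial j (1 : F))) ⟨0, hm⟩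
    rw [← X_pow_eq_monomial, ← X_pow_eq_monomial, bar_X_pow hm, ← pow_add, coeffVec_X_pow hm,
      coeffVec_X_pow hm, coeffVec_X_pow hm, single_one_dotProduct, Pi.single_apply,
      Pi.single_apply]
    refine if_congr ?_ rfl rfl
    rw [Fin.mk.injEq, Fin.mk.injEq, Nat.add_mod_mod, eq_comm (a := 0), ← Nat.dvd_iff_mod_eq_zero]
    have h₁ : i + (m - j % m) ≡ i % m + (m - j % m) [MOD m] :=
      (Nat.mod_modEq i m).symm.add_right _
    rw [h₁.dvd_iff dvd_rfl]
    have hi := Nat.mod_lt i hm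
    have hj := Nat.mod_lt j hm
    constructor
    · intro h
      rw [h, Nat.add_sub_cancel' hj.le]
    · rintro ⟨q, hq⟩
      -- The sum `i % m + (m - j % m)` lies strictly between `0` and `2m`.
      have hq1 : q = 1 := by
        have h₂ : 0 < m * q := by omega
        have h₃ : m * q < m * 2 := by omega
        have h₄ := Nat.lt_of_mul_lt_mul_left h₃
        have h₅ := Nat.pos_of_mul_pos_left h₂
        omega
      subst hq1
      omega
  exact LinearMap.congr_fun₂ h k l

theorem blockVec_dotProduct (hm : 0 < m) (k l : F[X] × F[X]) :
    blockVec m k ⬝ᵥ blockVec m l =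
      coeffVec m (k.1 * bar m l.1 + k.2 * bar m l.2) ⟨0, hm⟩ := by
  rw [map_add, Pi.add_apply, ← coeffVec_dotProduct hm, ← coeffVec_dotProduct hm]
  simp [blockVec, dotProduct]

theorem blockVec_eq_zero_iff (hm : 0 < m) {k : F[X] × F[X]} :
    blockVec m k = 0 ↔ X ^ m - 1 ∣ k.1 ∧ X ^ m - 1 ∣ k.2 := by
  rw [← coeffVec_eq_zero_iff hm, ← coeffVec_eq_zero_iff hm]
  constructor
  · intro h
    exact ⟨funext fun i => congrFun h (Sum.inl i), funext fun i => congrFun h (Sum.inr i)⟩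
  · rintro ⟨h₁, h₂⟩
    funext i
    cases i with
    | inl i => exact congrFun h₁ i
    | inr i => exact congrFun h₂ i

/-- Orthogonality of all words with polynomial multiples of `k` and `l` from one congruence. -/
theorem blockVec_smul_dotProduct_eq_zero (hm : 0 < m) {k l : F[X] × F[X]}
    (h : X ^ m - 1 ∣ k.1 * bar m l.1 + k.2 * bar m l.2) (a b : F[X]) :
    blockVec m (a • k) ⬝ᵥ blockVec m (b • l) = 0 := by
  rw [blockVec_dotProduct hm]
  refine congrFun ((coeffVec_eq_zero_iff hm).2 ?_) _
  rw [← AdjoinRoot.mk_eq_zero] at h ⊢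
  simp only [Prod.smul_fst, Prod.smul_snd, smul_eq_mul, map_add, map_mul, mk_bar hm] at h ⊢
  -- In the quotient conjugation is multiplicative, so `a` and the conjugate of `b` factor out.
  linear_combination AdjoinRoot.mk (X ^ m - 1) a * aeval _ b * h

theorem mem_twoGenCode {g₁ g₂ v₁ v₂ : F[X]} {u : Fin m ⊕ Fin m → F} :
    u ∈ twoGenCode m g₁ g₂ v₁ v₂ ↔
      ∃ a b : F[X], blockVec m (a • (g₁, v₁ * g₁) + b • (v₂ * g₂, g₂)) = u := by
  simp only [twoGenCode, qcCode, Submodule.mem_map, Submodule.restrictScalars_mem,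
    Submodule.mem_span_pair]
  constructor
  · rintro ⟨k, ⟨a, b, rfl⟩, rfl⟩
    exact ⟨a, b, rfl⟩
  · rintro ⟨a, b, rfl⟩
    exact ⟨_, ⟨a, b, rfl⟩, rfl⟩

theorem mul_parityCheck {g : F[X]} (hd : g ∣ X ^ m - 1) :
    g * parityCheck m g = X ^ m - 1 := by
  obtain rfl | hg := eq_or_ne g 0
  · rw [zero_mul, zero_dvd_iff.1 hd]
  · exact EuclideanDomain.mul_div_cancel' hg hd

theorem isEuclideanSelfOrthogonal_twoGenCode (hm : 0 < m) {g₁ g₂ v₁ v₂ : F[X]}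
    (hd₁ : g₁ ∣ X ^ m - 1) (hd₂ : g₂ ∣ X ^ m - 1)
    (h₁ : parityCheck m g₁ ∣ bar m g₁ * (1 + v₁ * bar m v₁))
    (h₂ : parityCheck m g₁ ∣ bar m g₂ * (bar m v₂ + v₁))
    (h₃ : parityCheck m g₂ ∣ bar m g₂ * (1 + v₂ * bar m v₂)) :
    IsEuclideanSelfOrthogonal (twoGenCode m g₁ g₂ v₁ v₂) := by
  -- Since `gᵢ hᵢ = x^m - 1`, multiplying by `gᵢ` turns each hypothesis into the vanishing of one
  -- pairing of generators.
  have H₁ := mul_dvd_mul_left g₁ h₁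
  have H₂ := mul_dvd_mul_left g₁ h₂
  have H₃ := mul_dvd_mul_left g₂ h₃
  rw [mul_parityCheck hd₁] at H₁ H₂
  rw [mul_parityCheck hd₂] at H₃
  have e₁₁ := blockVec_smul_dotProduct_eq_zero hm (k := (g₁, v₁ * g₁)) (l := (g₁, v₁ * g₁)) (by
    rw [← AdjoinRoot.mk_eq_zero] at H₁ ⊢
    simp only [map_add, map_mul, mk_bar hm, map_one] at H₁ ⊢
    linear_combination H₁)
  have e₁₂ := blockVec_smul_dotProduct_eq_zero hm (k := (g₁, v₁ * g₁)) (l := (v₂ * g₂, g₂)) (by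
    rw [← AdjoinRoot.mk_eq_zero] at H₂ ⊢
    simp only [map_add, map_mul, mk_bar hm] at H₂ ⊢
    linear_combination H₂)
  have e₂₂ := blockVec_smul_dotProduct_eq_zero hm (k := (v₂ * g₂, g₂)) (l := (v₂ * g₂, g₂)) (by
    rw [← AdjoinRoot.mk_eq_zero] at H₃ ⊢
    simp only [map_add, map_mul, mk_bar hm, map_one] at H₃ ⊢
    linear_combination H₃)
  intro u hu w hw
  obtain ⟨a, b, rfl⟩ := mem_twoGenCode.1 hu
  obtain ⟨a', b', rfl⟩ := mem_twoGenCode.1 hw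
  rw [map_add, map_add, add_dotProduct, dotProduct_add, dotProduct_add, e₁₁, e₁₂, e₂₂,
    dotProduct_comm, e₁₂]
  simp

/-- Modulo `N`, the matrix `(1, v₁; v₂, 1)` is invertible if `v₁ v₂ - 1` is a unit. -/
theorem dvd_and_dvd_of_isCoprime {N v₁ v₂ x y : F[X]} (hv : IsCoprime (v₁ * v₂ - 1) N)
    (h₁ : N ∣ x + y * v₂) (h₂ : N ∣ x * v₁ + y) : N ∣ x ∧ N ∣ y := by
  constructor
  -- Eliminating `y` leaves `(v₁v₂ - 1) x`.
  · refine hv.symm.dvd_of_dvd_mul_left ?_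
    convert dvd_sub (h₂.mul_left v₂) h₁ using 1
    ring
  · refine hv.symm.dvd_of_dvd_mul_left ?_
    convert dvd_sub (h₁.mul_left v₁) h₂ using 1
    ring

theorem degree_parityCheck (hm : 0 < m) {g : F[X]} (hd : g ∣ X ^ m - 1) :
    (parityCheck m g).degree = (m - g.natDegree : ℕ) := by
  have h := mul_parityCheck hd
  have h₀ := (monic_X_pow_sub_one (F := F) hm).ne_zero
  rw [← h] at h₀
  have h₁ := natDegree_mul (left_ne_zero_of_mul h₀) (right_ne_zero_of_mul h₀)
  rw [h, natDegree_X_pow_sub_one] at h₁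
  rw [degree_eq_natDegree (right_ne_zero_of_mul h₀)]
  congr 1
  omega

/-- Cancelling `g` shows that the parity-check polynomial divides `a`, whose degree is smaller. -/
theorem eq_zero_of_X_pow_sub_one_dvd_mul (hm : 0 < m) {g a : F[X]} (hd : g ∣ X ^ m - 1)
    (ha : a ∈ degreeLT F (m - g.natDegree)) (h : X ^ m - 1 ∣ a * g) : a = 0 := by
  rw [mem_degreeLT, ← degree_parityCheck hm hd] at ha
  have h₀ := (monic_X_pow_sub_one (F := F) hm).ne_zero
  rw [← mul_parityCheck hd] at h h₀
  rw [mul_comm a] at h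
  exact eq_zero_of_dvd_of_degree_lt ((mul_dvd_mul_iff_left (left_ne_zero_of_mul h₀)).1 h) ha

/-- Multipliers of `g` matter only modulo the parity-check polynomial, so the remainder serves as
`a'`. -/
theorem exists_mem_degreeLT_dvd_sub (hm : 0 < m) {g : F[X]} (hd : g ∣ X ^ m - 1) (a : F[X]) :
    ∃ a' ∈ degreeLT F (m - g.natDegree), X ^ m - 1 ∣ (a - a') * g := by
  have h₀ := (monic_X_pow_sub_one (F := F) hm).ne_zero
  rw [← mul_parityCheck hd] at h₀
  refine ⟨a % parityCheck m g, ?_, ?_⟩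
  · rw [mem_degreeLT, ← degree_parityCheck hm hd]
    exact EuclideanDomain.mod_lt _ (right_ne_zero_of_mul h₀)
  · rw [← mul_parityCheck hd, mul_comm _ g]
    refine mul_dvd_mul_left _ (Dvd.intro (a / parityCheck m g) ?_)
    rw [eq_sub_iff_add_eq, EuclideanDomain.div_add_mod]

/-- The encoder sending `(a, b)` to the word of `a (g₁, v₁ g₁) + b (v₂ g₂, g₂)`. -/
noncomputable def twoGenEncoder (m : ℕ) (g₁ g₂ v₁ v₂ : F[X]) :
    degreeLT F (m - g₁.natDegree) × degreeLT F (m - g₂.natDegree) →ₗ[F]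
      (Fin m ⊕ Fin m → F) :=
  (blockVec m).comp
    (((LinearMap.toSpanSingleton F[X] _ (g₁, v₁ * g₁)).restrictScalars F).comp
      (degreeLT F (m - g₁.natDegree)).subtype |>.coprod
    (((LinearMap.toSpanSingleton F[X] _ (v₂ * g₂, g₂)).restrictScalars F).comp
      (degreeLT F (m - g₂.natDegree)).subtype))

theorem twoGenEncoder_apply (g₁ g₂ v₁ v₂ : F[X])
    (k : degreeLT F (m - g₁.natDegree) × degreeLT F (m - g₂.natDegree)) :
    twoGenEncoder m g₁ g₂ v₁ v₂ k =
      blockVec m ((k.1 : F[X]) • (g₁, v₁ * g₁) + (k.2 : F[X]) • (v₂ * g₂, g₂)) := rfl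

theorem twoGenEncoder_injective (hm : 0 < m) {g₁ g₂ v₁ v₂ : F[X]}
    (hd₁ : g₁ ∣ X ^ m - 1) (hd₂ : g₂ ∣ X ^ m - 1)
    (hv : IsCoprime (v₁ * v₂ - 1) (X ^ m - 1)) :
    Function.Injective (twoGenEncoder m g₁ g₂ v₁ v₂) := by
  rw [injective_iff_map_eq_zero]
  rintro ⟨⟨a, ha⟩, ⟨b, hb⟩⟩ h
  rw [twoGenEncoder_apply, blockVec_eq_zero_iff hm] at h
  -- Coprimality decouples the two generators, leaving one cyclic code for each.
  obtain ⟨h₁, h₂⟩ := dvd_and_dvd_of_isCoprime (x := a * g₁) (y := b * g₂) hv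
    (by convert h.1 using 1; simp; ring) (by convert h.2 using 1; simp; ring)
  obtain rfl := eq_zero_of_X_pow_sub_one_dvd_mul hm hd₁ ha h₁
  obtain rfl := eq_zero_of_X_pow_sub_one_dvd_mul hm hd₂ hb h₂
  rfl

theorem range_twoGenEncoder (hm : 0 < m) {g₁ g₂ v₁ v₂ : F[X]}
    (hd₁ : g₁ ∣ X ^ m - 1) (hd₂ : g₂ ∣ X ^ m - 1) :
    LinearMap.range (twoGenEncoder m g₁ g₂ v₁ v₂) = twoGenCode m g₁ g₂ v₁ v₂ := by
  ext u
  rw [mem_twoGenCode]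
  constructor
  · rintro ⟨k, rfl⟩
    exact ⟨_, _, (twoGenEncoder_apply g₁ g₂ v₁ v₂ k).symm⟩
  · rintro ⟨a, b, rfl⟩
    obtain ⟨a', ha', ha⟩ := exists_mem_degreeLT_dvd_sub hm hd₁ a
    obtain ⟨b', hb', hb⟩ := exists_mem_degreeLT_dvd_sub hm hd₂ b
    refine ⟨(⟨a', ha'⟩, ⟨b', hb'⟩), ?_⟩
    rw [twoGenEncoder_apply, ← sub_eq_zero, ← neg_sub, neg_eq_zero, ← map_sub,
      blockVec_eq_zero_iff hm]
    constructor
    · convert dvd_add ha (hb.mul_left v₂) using 1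
      simp
      ring
    · convert dvd_add (ha.mul_left v₁) hb using 1
      simp
      ring

theorem finrank_degreeLT (n : ℕ) : Module.finrank F (degreeLT F n) = n := by
  rw [(degreeLTEquiv F n).finrank_eq, Module.finrank_fin_fun]

theorem finrank_twoGenCode (hm : 0 < m) {g₁ g₂ v₁ v₂ : F[X]}
    (hd₁ : g₁ ∣ X ^ m - 1) (hd₂ : g₂ ∣ X ^ m - 1)
    (hv : IsCoprime (v₁ * v₂ - 1) (X ^ m - 1)) :
    Module.finrank F (twoGenCode m g₁ g₂ v₁ v₂) = (m - g₁.natDegree) + (m - g₂.natDegree) := by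
  have (n : ℕ) : Module.Finite F (degreeLT F n) := .equiv (degreeLTEquiv F n).symm
  rw [← range_twoGenEncoder hm hd₁ hd₂,
    LinearMap.finrank_range_of_inj (twoGenEncoder_injective hm hd₁ hd₂ hv),
    Module.finrank_prod, finrank_degreeLT, finrank_degreeLT]

theorem natDegree_le_of_dvd_X_pow_sub_one (hm : 0 < m) {g : F[X]} (hd : g ∣ X ^ m - 1) :
    g.natDegree ≤ m := by
  simpa only [natDegree_X_pow_sub_one] using
    natDegree_le_of_dvd hd (monic_X_pow_sub_one hm).ne_zero

end Cyclic

end QuasiCyclic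

theorem mainTheorem6 (p : ℕ) [Fact p.Prime] {F : Type*} [Field F] [Fintype F] [DecidableEq F]
    [Algebra (ZMod p) F] (m : ℕ) (hm : 0 < m) (g₁ g₂ v₁ v₂ : F[X])
    (hg₁ : g₁.Monic) (hg₂ : g₂.Monic)
    (hd₁ : g₁ ∣ X ^ m - 1) (hd₂ : g₂ ∣ X ^ m - 1)
    (hv : IsCoprime (v₁ * v₂ - 1) (X ^ m - 1))
    (h₁ : QuasiCyclic.parityCheck m g₁ ∣
      QuasiCyclic.bar m g₁ * (1 + v₁ * QuasiCyclic.bar m v₁))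
    (h₂ : QuasiCyclic.parityCheck m g₁ ∣
      QuasiCyclic.bar m g₂ * (QuasiCyclic.bar m v₂ + v₁))
    (h₃ : QuasiCyclic.parityCheck m g₂ ∣
      QuasiCyclic.bar m g₂ * (1 + v₂ * QuasiCyclic.bar m v₂)) :
    QuasiCyclic.IsEuclideanSelfOrthogonal (QuasiCyclic.twoGenCode m g₁ g₂ v₁ v₂) ∧
    QuasiCyclic.IsLinearCode (QuasiCyclic.twoGenCode m g₁ g₂ v₁ v₂)
      (2 * m) (2 * m - g₁.natDegree - g₂.natDegree) ∧
    m ≤ g₁.natDegree + g₂.natDegree ∧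
    ∃ Q : Submodule ℂ ((Fin m ⊕ Fin m → F) → ℂ),
      QuasiCyclic.IsQuantumStabilizerCode p Q
        (2 * m) (2 * (g₁.natDegree + g₂.natDegree - m))
        (QuasiCyclic.minWeight
          {u : Fin m ⊕ Fin m → F |
            u ∈ QuasiCyclic.euclideanDual (QuasiCyclic.twoGenCode m g₁ g₂ v₁ v₂) ∧
              u ∉ QuasiCyclic.twoGenCode m g₁ g₂ v₁ v₂}) := by
  have hC := QuasiCyclic.isEuclideanSelfOrthogonal_twoGenCode hm hd₁ hd₂ h₁ h₂ h₃
  have hk := QuasiCyclic.finrank_twoGenCode hm hd₁ hd₂ hv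
  have hn₁ := QuasiCyclic.natDegree_le_of_dvd_X_pow_sub_one hm hd₁
  have hn₂ := QuasiCyclic.natDegree_le_of_dvd_X_pow_sub_one hm hd₂
  have hcard : Fintype.card (Fin m ⊕ Fin m) = 2 * m := by
    rw [Fintype.card_sum, Fintype.card_fin, two_mul]
  have hle := hC.two_mul_finrank_le
  refine ⟨hC, ⟨hcard, by omega⟩, by omega,
    QuasiCyclic.stabilizedSpace p (QuasiCyclic.twoGenCode m g₁ g₂ v₁ v₂), ?_⟩
  have hQ := QuasiCyclic.isQuantumStabilizerCode_stabilizedSpace p hC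
  rw [hcard, hk] at hQ
  -- Only the exponents differ: `2m - 2((m - deg g₁) + (m - deg g₂)) = 2(deg g₁ + deg g₂ - m)`,
  -- where `deg gᵢ ≤ m` and the bound `hle` keep the truncated subtractions exact.
  convert hQ using 1
  omega
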